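/- Let $k$ be a field with $\operatorname{char} k\neq 2,3$ and algebraic closure $\overline k$, and let $U(x_1,x_2)=ax_1^4+bx_1^3x_2+cx_1^2x_2^2+dx_1x_2^3+ex_2^4$ be the generic binary quartic, with coefficients $a,b,c,d,e$ regarded as indeterminates. Put $$c_4=2^4(12ae-3bd+c^2),\qquad c_6=2^5(72ace-27ad^2-27b^2e+9bcd-2c^3),$$ $$H=\tfrac13\det\Big(\frac{\partial^2U}{\partial x_i\partial x_j}\Big)_{i,j=1,2},\qquad J=\tfrac1{12}\Big(\frac{\partial U}{\partial x_1}\frac{\partial H}{\partial x_2}-\frac{\partial U}{\partial x_2}\frac{\partial H}{\partial x_1}\Big),$$ and let $k[c_4,c_6,U,H]$ be the $k$-subalgebra of $k[a,b,c,d,e][x_1,x_2]$ generated by $c_4,c_6,U,H$. Write $\mathbf x=(x_1,x_2)^T$ and, for $F\in k[a,b,c,d,e][x_1,x_2]$, write $\partial F=\big(-\frac{\partial F}{\partial x_2},\frac{\partial F}{\partial x_1}\big)^T$. A covariant column of order $m\ge 0$, degree $n\ge 0$ and weight $p\in\mathbb Z$ is a column vector $\mathbf v=\mathbf v(U;\mathbf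 x)=(v_1,v_2)^T$ whose entries are homogeneous polynomials of degree $m$ in $x_1,x_2$ whose coefficients are homogeneous polynomials of degree $n$ in $a,b,c,d,e$ over $k$, such that $$\mathbf v(U\circ g;\mathbf x)=(\det g)^p\,g^{-1}\,\mathbf v(U;g\mathbf x)$$ for all $g\in\operatorname{GL}_2(\overline k)$ (and all binary quartics $U$ over $\overline k$), where $(U\circ g)(\mathbf x)=U(g\mathbf x)$. Then: (i) The set of finite sums of covariant columns of even weight (of arbitrary orders and degrees) is a free $k[c_4,c_6,U,H]$-module of rank $2$ with basis $\mathbf x$, $\partial J$. (ii) The set of finite sums of covariant columns of odd weight (of arbitrary orders and degrees) is a free $k[c_4,c_6,U,H]$-module of rank $2$ with basis $\partial U$, $\partial H$. -/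

import Mathlib

open MvPolynomial

noncomputable section

namespace BinaryQuartic

/-- The ring `k[a, b, c, d, e]` of polynomials in the coefficients of the binary quartic;
the variables `X 0, …, X 4` are `a, b, c, d, e`. -/
abbrev CoeffRing (k : Type*) [Field k] : Type _ := MvPolynomial (Fin 5) k

/-- The ring `k[a, b, c, d, e][x₁, x₂]`; the variables `X 0, X 1` are `x₁, x₂`. -/
abbrev FormRing (k : Type*) [Field k] : Type _ := MvPolynomial (Fin 2) (CoeffRing k)

/-- Column vectors `(v₁, v₂)ᵀ` with entries in `k[a, b, c, d, e][x₁, x₂]`. -/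
abbrev Column (k : Type*) [Field k] : Type _ := Fin 2 → FormRing k

/-- The binary quartic `u₀ x₁⁴ + u₁ x₁³ x₂ + u₂ x₁² x₂² + u₃ x₁ x₂³ + u₄ x₂⁴`. -/
def quartic {S : Type*} [CommRing S] (u : Fin 5 → S) : MvPolynomial (Fin 2) S :=
  ∑ i : Fin 5, C (u i) * X 0 ^ (4 - (i : ℕ)) * X 1 ^ (i : ℕ)

/-- The composite `F ∘ g`, that is, `F (g₁₁ x₁ + g₁₂ x₂, g₂₁ x₁ + g₂₂ x₂)`. -/
def comp {S : Type*} [CommRing S] (F : MvPolynomial (Fin 2) S) (g : Matrix (Fin 2) (Fin 2) S) :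
    MvPolynomial (Fin 2) S :=
  aeval (fun i : Fin 2 => ∑ j : Fin 2, C (g i j) * (X j : MvPolynomial (Fin 2) S)) F

/-- The coefficients of the quartic `U ∘ g`, where `U` has coefficients `u`. -/
def compCoeffs {S : Type*} [CommRing S] (u : Fin 5 → S) (g : Matrix (Fin 2) (Fin 2) S) :
    Fin 5 → S :=
  fun i => coeff (Finsupp.single 0 (4 - (i : ℕ)) + Finsupp.single 1 (i : ℕ)) (comp (quartic u) g)

/-- The value `F (U; x)` of `F ∈ k[a, b, c, d, e][x₁, x₂]` at the quartic `U` with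
coefficients `u` in a `k`-algebra `S`; it is a polynomial in `x₁, x₂` over `S`. -/
def atQuartic {k : Type*} [Field k] {S : Type*} [CommRing S] [Algebra k S]
    (F : FormRing k) (u : Fin 5 → S) : MvPolynomial (Fin 2) S :=
  MvPolynomial.map (aeval u : CoeffRing k →ₐ[k] S).toRingHom F

/-- `v` is a covariant column of order `m`, degree `d` and weight `p`: its entries are homogeneous
of degree `m` in `x₁, x₂`, with coefficients that are homogeneous of degree `d` in
`a, b, c, d, e`, and `v (U ∘ g; x) = (det g) ^ p g⁻¹ v (U; g x)` for all binary quartics `U` over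
the algebraic closure of `k` and all `g` in `GL₂` of the algebraic closure. -/
structure IsCovariantColumn {k : Type*} [Field k] (m d : ℕ) (p : ℤ) (v : Column k) : Prop where
  order : ∀ i, (v i).IsHomogeneous m
  degree : ∀ i s, (coeff s (v i)).IsHomogeneous d
  equivariant : ∀ (g : GL (Fin 2) (AlgebraicClosure k)) (u : Fin 5 → AlgebraicClosure k)
    (i : Fin 2),
    atQuartic (v i) (compCoeffs u (g : Matrix (Fin 2) (Fin 2) (AlgebraicClosure k))) =
      C ((Matrix.det (g : Matrix (Fin 2) (Fin 2) (AlgebraicClosure k))) ^ p) *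
        ∑ j : Fin 2,
          C (((g⁻¹ : GL (Fin 2) (AlgebraicClosure k)) :
              Matrix (Fin 2) (Fin 2) (AlgebraicClosure k)) i j) *
            comp (atQuartic (v j) u) (g : Matrix (Fin 2) (Fin 2) (AlgebraicClosure k))

/-- The space of covariant columns of even weight: all finite sums of covariant columns whose
weights are even (of arbitrary orders and degrees). -/
def evenColumns (k : Type*) [Field k] : Submodule k (Column k) :=
  Submodule.span k {v | ∃ (m d : ℕ) (p : ℤ), Even p ∧ IsCovariantColumn m d p v}

/-- The space of covariant columns of odd weight: all finite sums of covariant columns whose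
weights are odd (of arbitrary orders and degrees). -/
def oddColumns (k : Type*) [Field k] : Submodule k (Column k) :=
  Submodule.span k {v | ∃ (m d : ℕ) (p : ℤ), Odd p ∧ IsCovariantColumn m d p v}

/-- The generic binary quartic `U = a x₁⁴ + b x₁³ x₂ + c x₁² x₂² + d x₁ x₂³ + e x₂⁴`. -/
def U (k : Type*) [Field k] : FormRing k :=
  quartic (fun i => X i)

/-- The invariant `c₄ = 2⁴ (12 a e - 3 b d + c²)`. -/
def c4 (k : Type*) [Field k] : FormRing k :=
  C (2 ^ 4 * (12 * X 0 * X 4 - 3 * X 1 * X 3 + X 2 ^ 2))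

/-- The invariant `c₆ = 2⁵ (72 a c e - 27 a d² - 27 b² e + 9 b c d - 2 c³)`. -/
def c6 (k : Type*) [Field k] : FormRing k :=
  C (2 ^ 5 * (72 * X 0 * X 2 * X 4 - 27 * X 0 * X 3 ^ 2 - 27 * X 1 ^ 2 * X 4
    + 9 * X 1 * X 2 * X 3 - 2 * X 2 ^ 3))

/-- The covariant `H = (1/3) det (∂²U / ∂xᵢ ∂xⱼ)`. -/
def H (k : Type*) [Field k] : FormRing k :=
  (3⁻¹ : k) • (Matrix.of fun i j : Fin 2 => pderiv i (pderiv j (U k))).det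

/-- The covariant `J = (1/12) ∂(U, H) / ∂(x₁, x₂)`. -/
def J (k : Type*) [Field k] : FormRing k :=
  (12⁻¹ : k) • (pderiv 0 (U k) * pderiv 1 (H k) - pderiv 1 (U k) * pderiv 0 (H k))

/-- The column vector `x = (x₁, x₂)ᵀ`. -/
def xColumn (k : Type*) [Field k] : Column k :=
  ![X 0, X 1]

/-- The column vector `∂F = (-∂F/∂x₂, ∂F/∂x₁)ᵀ`. -/
def del {k : Type*} [Field k] (F : FormRing k) : Column k :=
  ![-pderiv 1 F, pderiv 0 F]

/-- The ring `k[c₄, c₆, U, H]`, as a subalgebra of `k[a, b, c, d, e][x₁, x₂]`. -/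
def scalarRing (k : Type*) [Field k] : Subalgebra k (FormRing k) :=
  Algebra.adjoin k {c4 k, c6 k, U k, H k}

/-- The subset `V` of the `A`-module `N` is an `A`-submodule, and as such it is a free `A`-module
with basis `(e i)`, `i ∈ ι`. -/
def IsFreeSubmoduleWithBasis (A : Type*) {N ι : Type*} [CommRing A] [AddCommGroup N] [Module A N]
    (V : Set N) (e : ι → N) : Prop :=
  ∃ M : Submodule A N, (M : Set N) = V ∧ ∃ B : Module.Basis ι A M, ∀ i, (B i : N) = e i

end BinaryQuartic

end

/-! The proof is Cramer's rule. For two columns of the same weight parity, the determinant with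
these columns is a scalar covariant of odd weight. Every such covariant lies in `J · k[c₄, c₆, U,
H]` (`IsSemiinvariant.exists_eq_J_mul`). The proposed bases have determinant `6 J` (Euler's
identity) and `12 J` (definition of `J`), so Cramer's rule expresses any column in the basis with
coefficients in `k[c₄, c₆, U, H]`, and `J ≠ 0` gives independence
(`isFreeSubmoduleWithBasis_of_wedge`).

The statement on odd covariants is proved on leading coefficients, since a covariant is determined
by its value at `(1, 0)`. Such a seminvariant `f` does not change when a quartic with `a ≠ 0` is
translated to remove its `x₁³x₂` term. The new coefficients are, up to powers of `a`, polynomials in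
`c₄` and the leading coefficients `a`, `H₀`, `J₀` of `U`, `H`, `J`. As `J₀²` is a polynomial in `c₄,
c₆, a, H₀`, this gives `a^N f = P + J₀ Q` with `P`, `Q` polynomials in these four. Oddness under `x₂
↦ -x₂` removes `P`. The power of `a` cancels because on `a = 0` one has `J₀ = b³`, while `c₄, c₆,
H₀` remain algebraically independent there, so `Q` is divisible by the variable standing for `a`.

Only matrices with `det² = 1` are used in this direction: they see exactly the parity of the weight,
so sums of columns of different weights, orders and degrees need no decomposition. -/

noncomputable section

namespace BinaryQuartic

/-! ### Linear substitutions in binary quartics and the chain rule. -/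

section Substitution

variable {S : Type*} [CommRing S]

/-- The coefficients of `U ∘ g` for the matrix `g` with rows `(p, q)` and `(r, s)`. -/
def substCoeffs (u : Fin 5 → S) (p q r s : S) : Fin 5 → S :=
  ![u 0 * p ^ 4 + u 1 * p ^ 3 * r + u 2 * p ^ 2 * r ^ 2 + u 3 * p * r ^ 3 + u 4 * r ^ 4,
    4 * u 0 * p ^ 3 * q + u 1 * (3 * p ^ 2 * q * r + p ^ 3 * s)
      + u 2 * (2 * p * q * r ^ 2 + 2 * p ^ 2 * r * s) + u 3 * (q * r ^ 3 + 3 * p * r ^ 2 * s)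
      + 4 * u 4 * r ^ 3 * s,
    6 * u 0 * p ^ 2 * q ^ 2 + u 1 * (3 * p * q ^ 2 * r + 3 * p ^ 2 * q * s)
      + u 2 * (q ^ 2 * r ^ 2 + 4 * p * q * r * s + p ^ 2 * s ^ 2)
      + u 3 * (3 * q * r ^ 2 * s + 3 * p * r * s ^ 2) + 6 * u 4 * r ^ 2 * s ^ 2,
    4 * u 0 * p * q ^ 3 + u 1 * (q ^ 3 * r + 3 * p * q ^ 2 * s)
      + u 2 * (2 * q ^ 2 * r * s + 2 * p * q * s ^ 2) + u 3 * (3 * q * r * s ^ 2 + p * s ^ 3)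
      + 4 * u 4 * r * s ^ 3,
    u 0 * q ^ 4 + u 1 * q ^ 3 * s + u 2 * q ^ 2 * s ^ 2 + u 3 * q * s ^ 3 + u 4 * s ^ 4]

theorem quartic_eq (u : Fin 5 → S) :
    quartic u = C (u 0) * X 0 ^ 4 + C (u 1) * X 0 ^ 3 * X 1 + C (u 2) * X 0 ^ 2 * X 1 ^ 2
      + C (u 3) * X 0 * X 1 ^ 3 + C (u 4) * X 1 ^ 4 := by
  simp [quartic, Fin.sum_univ_five]

theorem coeff_quartic (u : Fin 5 → S) (i : Fin 5) :
    coeff (Finsupp.single 0 (4 - (i : ℕ)) + Finsupp.single 1 (i : ℕ)) (quartic u) = u i := by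
  have key (j : Fin 5) : C (u j) * X 0 ^ (4 - (j : ℕ)) * X 1 ^ (j : ℕ)
      = monomial (Finsupp.single (0 : Fin 2) (4 - (j : ℕ)) + Finsupp.single 1 (j : ℕ)) (u j) := by
    rw [X_pow_eq_monomial, X_pow_eq_monomial, C_mul_monomial, monomial_mul]
    simp
  rw [quartic, coeff_sum, Finset.sum_eq_single i]
  · rw [key, coeff_monomial, if_pos rfl]
  · intro j _ hj
    rw [key, coeff_monomial, if_neg]
    intro h
    have := DFunLike.congr_fun h 1
    simp at this
    exact hj (Fin.ext this)
  · simp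

theorem comp_quartic (u : Fin 5 → S) (g : Matrix (Fin 2) (Fin 2) S) :
    comp (quartic u) g = quartic (substCoeffs u (g 0 0) (g 0 1) (g 1 0) (g 1 1)) := by
  rw [quartic_eq, quartic_eq]
  simp only [comp, substCoeffs, map_add, map_mul, map_pow, aeval_X, Fin.sum_univ_two, map_ofNat,
    algHom_C, algebraMap_eq, Matrix.cons_val]
  ring

theorem compCoeffs_eq (u : Fin 5 → S) (g : Matrix (Fin 2) (Fin 2) S) :
    compCoeffs u g = substCoeffs u (g 0 0) (g 0 1) (g 1 0) (g 1 1) := by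
  ext i
  rw [compCoeffs, comp_quartic, coeff_quartic]

theorem quartic_compCoeffs (u : Fin 5 → S) (g : Matrix (Fin 2) (Fin 2) S) :
    quartic (compCoeffs u g) = comp (quartic u) g := by
  rw [compCoeffs_eq, comp_quartic]

theorem comp_add (F G : MvPolynomial (Fin 2) S) (g : Matrix (Fin 2) (Fin 2) S) :
    comp (F + G) g = comp F g + comp G g := map_add _ _ _

theorem comp_sub (F G : MvPolynomial (Fin 2) S) (g : Matrix (Fin 2) (Fin 2) S) :
    comp (F - G) g = comp F g - comp G g := map_sub _ _ _

theorem comp_neg (F : MvPolynomial (Fin 2) S) (g : Matrix (Fin 2) (Fin 2) S) :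
    comp (-F) g = -comp F g := map_neg _ _

theorem comp_mul (F G : MvPolynomial (Fin 2) S) (g : Matrix (Fin 2) (Fin 2) S) :
    comp (F * G) g = comp F g * comp G g := map_mul _ _ _

theorem comp_C (a : S) (g : Matrix (Fin 2) (Fin 2) S) : comp (C a) g = C a := by
  simp [comp]

theorem comp_zero (g : Matrix (Fin 2) (Fin 2) S) : comp 0 g = 0 := map_zero _

theorem comp_one (g : Matrix (Fin 2) (Fin 2) S) : comp 1 g = 1 := map_one _

theorem comp_X (i : Fin 2) (g : Matrix (Fin 2) (Fin 2) S) :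
    comp (X i) g = C (g i 0) * X 0 + C (g i 1) * X 1 := by
  simp [comp, Fin.sum_univ_two]

theorem eval_comp (F : MvPolynomial (Fin 2) S) (g : Matrix (Fin 2) (Fin 2) S) (x : Fin 2 → S) :
    eval x (comp F g) = eval (g.mulVec x) F := by
  induction F using MvPolynomial.induction_on with
  | C a => simp [comp_C]
  | add F G hF hG => simp [comp_add, hF, hG]
  | mul_X F i hF =>
    fin_cases i <;> simp [comp_mul, hF, comp_X]

/-- The chain rule for a linear substitution. -/
theorem pderiv_comp (F : MvPolynomial (Fin 2) S) (g : Matrix (Fin 2) (Fin 2) S) (i : Fin 2) :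
    pderiv i (comp F g)
      = C (g 0 i) * comp (pderiv 0 F) g + C (g 1 i) * comp (pderiv 1 F) g := by
  induction F using MvPolynomial.induction_on with
  | C a => simp [comp]
  | add F G hF hG =>
    simp only [comp_add, map_add, hF, hG]
    ring
  | mul_X F j hF =>
    rw [comp_mul, pderiv_mul, hF, pderiv_mul, pderiv_mul, comp_add, comp_add, comp_mul, comp_mul,
      comp_mul, comp_mul, comp_X]
    fin_cases i <;> fin_cases j <;>
      simp [pderiv_X, comp_zero, comp_one] <;> ring

end Substitution

variable {k : Type*} [Field k]

/-! ### Specialization of the generic quartic. -/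

section Specialization

variable {S : Type*} [CommRing S] [Algebra k S] (u : Fin 5 → S)

theorem atQuartic_add (F G : FormRing k) : atQuartic (F + G) u = atQuartic F u + atQuartic G u :=
  map_add _ _ _

theorem atQuartic_sub (F G : FormRing k) : atQuartic (F - G) u = atQuartic F u - atQuartic G u :=
  map_sub _ _ _

theorem atQuartic_neg (F : FormRing k) : atQuartic (-F) u = -atQuartic F u :=
  map_neg _ _

theorem atQuartic_mul (F G : FormRing k) : atQuartic (F * G) u = atQuartic F u * atQuartic G u :=
  map_mul _ _ _

theorem atQuartic_C (f : CoeffRing k) : atQuartic (C f) u = C (aeval u f) :=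
  map_C _ _

theorem atQuartic_X (i : Fin 2) : atQuartic (X i : FormRing k) u = X i :=
  map_X _ _

theorem smul_eq_C_C_mul (c : k) (F : FormRing k) : c • F = C (C c) * F := by
  rw [← smul_eq_C_mul, ← algebraMap_eq, algebraMap_smul]

theorem atQuartic_smul (c : k) (F : FormRing k) :
    atQuartic (c • F) u = C (algebraMap k S c) * atQuartic F u := by
  rw [smul_eq_C_C_mul, atQuartic_mul, atQuartic_C, aeval_C]

theorem pderiv_atQuartic (F : FormRing k) (i : Fin 2) :
    pderiv i (atQuartic F u) = atQuartic (pderiv i F) u := pderiv_map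

theorem atQuartic_U : atQuartic (U k) u = quartic u := by
  simp [U, quartic_eq, atQuartic]

end Specialization

/-! ### Equivariance of `U`, `c₄`, `c₆`, `H`, `J`. -/

/-- `F (U ∘ g; x) = (det g) ^ p F (U; g x)` for all binary quartics `U` over the algebraic closure
and all invertible `g`. -/
def IsEquivariant (p : ℤ) (F : FormRing k) : Prop :=
  ∀ (g : GL (Fin 2) (AlgebraicClosure k)) (u : Fin 5 → AlgebraicClosure k),
    atQuartic F (compCoeffs u (g : Matrix (Fin 2) (Fin 2) (AlgebraicClosure k))) =
      C ((Matrix.det (g : Matrix (Fin 2) (Fin 2) (AlgebraicClosure k))) ^ p) *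
        comp (atQuartic F u) (g : Matrix (Fin 2) (Fin 2) (AlgebraicClosure k))

theorem isEquivariant_U : IsEquivariant 0 (U k) := by
  intro g u
  rw [atQuartic_U, atQuartic_U, quartic_compCoeffs]
  simp

theorem isEquivariant_c4 : IsEquivariant 4 (c4 k) := by
  intro g u
  rw [c4, atQuartic_C, atQuartic_C, comp_C, ← C_mul, compCoeffs_eq, Matrix.det_fin_two]
  congr 1
  simp only [substCoeffs, map_add, map_sub, map_mul, map_pow, aeval_X, map_ofNat,
    Matrix.cons_val, zpow_ofNat]
  ring

theorem isEquivariant_c6 : IsEquivariant 6 (c6 k) := by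
  intro g u
  rw [c6, atQuartic_C, atQuartic_C, comp_C, ← C_mul, compCoeffs_eq, Matrix.det_fin_two]
  congr 1
  simp only [substCoeffs, map_add, map_sub, map_mul, map_pow, aeval_X, map_ofNat,
    Matrix.cons_val, zpow_ofNat]
  ring

/-- The transformation rule of the gradient of a covariant. -/
theorem IsEquivariant.atQuartic_pderiv {p : ℤ} {F : FormRing k} (hF : IsEquivariant p F)
    (g : GL (Fin 2) (AlgebraicClosure k)) (u : Fin 5 → AlgebraicClosure k) (i : Fin 2) :
    atQuartic (pderiv i F) (compCoeffs u (g : Matrix (Fin 2) (Fin 2) (AlgebraicClosure k))) =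
      C ((Matrix.det (g : Matrix (Fin 2) (Fin 2) (AlgebraicClosure k))) ^ p) *
        (C (g 0 i) * comp (atQuartic (pderiv 0 F) u) (g : Matrix (Fin 2) (Fin 2) _) +
          C (g 1 i) * comp (atQuartic (pderiv 1 F) u) (g : Matrix (Fin 2) (Fin 2) _)) := by
  rw [← pderiv_atQuartic, hF g u, pderiv_C_mul, pderiv_comp, pderiv_atQuartic, pderiv_atQuartic]

theorem det_ne_zero (g : GL (Fin 2) (AlgebraicClosure k)) :
    Matrix.det (g : Matrix (Fin 2) (Fin 2) (AlgebraicClosure k)) ≠ 0 :=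
  ((Matrix.isUnit_iff_isUnit_det _).mp g.isUnit).ne_zero

/-- The Jacobian determinant of two covariants is a covariant. -/
theorem IsEquivariant.jacobian {p q : ℤ} {F G : FormRing k} (hF : IsEquivariant p F)
    (hG : IsEquivariant q G) :
    IsEquivariant (p + q + 1) (pderiv 0 F * pderiv 1 G - pderiv 1 F * pderiv 0 G) := by
  intro g u
  rw [atQuartic_sub, atQuartic_mul, atQuartic_mul, hF.atQuartic_pderiv, hF.atQuartic_pderiv,
    hG.atQuartic_pderiv, hG.atQuartic_pderiv, atQuartic_sub, atQuartic_mul, atQuartic_mul,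
    comp_sub, comp_mul, comp_mul, zpow_add_one₀ (det_ne_zero g), zpow_add₀ (det_ne_zero g),
    C_mul, C_mul]
  -- Only the extra factor `det g` produced by the Jacobian is expanded; the powers with exponents
  -- `p` and `q` stay opaque.
  nth_rw 7 [Matrix.det_fin_two]
  rw [C_sub, C_mul, C_mul]
  ring

theorem IsEquivariant.smul {p : ℤ} {F : FormRing k} (hF : IsEquivariant p F) (c : k) :
    IsEquivariant p (c • F) := by
  intro g u
  rw [atQuartic_smul, atQuartic_smul, hF g u, comp_mul, comp_C]
  ring

/-- The Hessian matrix transforms as `gᵀ (Hess U) g`, so its determinant acquires `(det g)²`. -/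
theorem isEquivariant_H : IsEquivariant 2 (H k) := by
  refine IsEquivariant.smul ?_ _
  have h (i j : Fin 2) (g : GL (Fin 2) (AlgebraicClosure k)) (u : Fin 5 → AlgebraicClosure k) :
      atQuartic (pderiv i (pderiv j (U k))) (compCoeffs u (g : Matrix (Fin 2) (Fin 2) _)) =
        C (g 0 j) * (C (g 0 i) * comp (atQuartic (pderiv 0 (pderiv 0 (U k))) u) (g : Matrix _ _ _)
          + C (g 1 i) * comp (atQuartic (pderiv 1 (pderiv 0 (U k))) u) (g : Matrix _ _ _))
        + C (g 1 j) * (C (g 0 i) * comp (atQuartic (pderiv 0 (pderiv 1 (U k))) u) (g : Matrix _ _ _)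
          + C (g 1 i) * comp (atQuartic (pderiv 1 (pderiv 1 (U k))) u) (g : Matrix _ _ _)) := by
    rw [← pderiv_atQuartic, isEquivariant_U.atQuartic_pderiv, zpow_zero, C_1, one_mul, map_add,
      pderiv_C_mul, pderiv_C_mul, pderiv_comp, pderiv_comp]
    simp only [pderiv_atQuartic]
  intro g u
  rw [Matrix.det_fin_two]
  simp only [Matrix.of_apply, atQuartic_sub, atQuartic_mul, h, comp_sub, comp_mul]
  rw [Matrix.det_fin_two, zpow_ofNat, C_pow, C_sub, C_mul, C_mul]
  ring

theorem isEquivariant_J : IsEquivariant 3 (J k) :=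
  (isEquivariant_U.jacobian isEquivariant_H).smul _

/-! ### Bidegrees. -/

/-- `F` is homogeneous of degree `m` in `x₁, x₂` with coefficients homogeneous of degree `d` in
`a, b, c, d, e`. -/
structure IsBihomogeneous (m d : ℕ) (F : FormRing k) : Prop where
  order : F.IsHomogeneous m
  degree : ∀ s, (coeff s F).IsHomogeneous d

namespace IsBihomogeneous

variable {m n d e : ℕ} {F G : FormRing k}

theorem add (hF : IsBihomogeneous m d F) (hG : IsBihomogeneous m d G) :
    IsBihomogeneous m d (F + G) :=
  ⟨hF.order.add hG.order, fun s => by rw [coeff_add]; exact (hF.degree s).add (hG.degree s)⟩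

theorem neg (hF : IsBihomogeneous m d F) : IsBihomogeneous m d (-F) :=
  ⟨hF.order.neg, fun s => by rw [coeff_neg]; exact (hF.degree s).neg⟩

theorem sub (hF : IsBihomogeneous m d F) (hG : IsBihomogeneous m d G) :
    IsBihomogeneous m d (F - G) :=
  sub_eq_add_neg F G ▸ hF.add hG.neg

theorem mul (hF : IsBihomogeneous m d F) (hG : IsBihomogeneous n e G) :
    IsBihomogeneous (m + n) (d + e) (F * G) :=
  ⟨hF.order.mul hG.order, fun s => by
    rw [coeff_mul]
    exact IsHomogeneous.sum _ _ _ fun i _ => (hF.degree i.1).mul (hG.degree i.2)⟩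

theorem of_C {f : CoeffRing k} (hf : f.IsHomogeneous d) : IsBihomogeneous 0 d (C f : FormRing k) :=
  ⟨isHomogeneous_C _ _, fun s => by
    rw [coeff_C]
    split_ifs
    · exact hf
    · exact isHomogeneous_zero _ _ _⟩

theorem of_X (i : Fin 2) : IsBihomogeneous 1 0 (X i : FormRing k) :=
  ⟨isHomogeneous_X _ _, fun s => by
    rw [coeff_X]
    split_ifs
    · exact isHomogeneous_one _ _
    · exact isHomogeneous_zero _ _ _⟩

theorem pow (hF : IsBihomogeneous m d F) (j : ℕ) : IsBihomogeneous (m * j) (d * j) (F ^ j) := by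
  induction j with
  | zero => simpa using of_C (k := k) (isHomogeneous_one (Fin 5) k)
  | succ j ih => simpa only [pow_succ, mul_add, mul_one] using ih.mul hF

theorem smul (hF : IsBihomogeneous m d F) (c : k) : IsBihomogeneous m d (c • F) := by
  rw [smul_eq_C_C_mul]
  simpa using (of_C (isHomogeneous_C (Fin 5) c)).mul hF

theorem pderiv (hF : IsBihomogeneous m d F) (i : Fin 2) :
    IsBihomogeneous (m - 1) d (MvPolynomial.pderiv i F) :=
  ⟨hF.order.pderiv, fun s => by
    rw [coeff_pderiv, ← Nat.cast_succ, ← map_natCast (C : k →+* CoeffRing k)]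
    simpa using (hF.degree _).mul (isHomogeneous_C (Fin 5) ((s i + 1 : ℕ) : k))⟩

end IsBihomogeneous

open IsBihomogeneous

theorem isBihomogeneous_U : IsBihomogeneous 4 1 (U k) := by
  rw [U, quartic_eq]
  have h (i : Fin 5) (p q : ℕ) : IsBihomogeneous (p + q) 1
      (C (X i) * X 0 ^ p * X 1 ^ q : FormRing k) := by
    simpa using ((of_C (isHomogeneous_X k i)).mul ((of_X 0).pow p)).mul ((of_X 1).pow q)
  simpa using ((((h 0 4 0).add (h 1 3 1)).add (h 2 2 2)).add (h 3 1 3)).add (h 4 0 4)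

theorem isBihomogeneous_c4 : IsBihomogeneous 0 2 (c4 k) := by
  refine of_C ?_
  have h (c : k) (i j : Fin 5) : (C c * X i * X j : CoeffRing k).IsHomogeneous 2 := by
    simpa using ((isHomogeneous_C _ c).mul (isHomogeneous_X k i)).mul (isHomogeneous_X k j)
  convert ((h (2 ^ 4 * 12) 0 4).add (h (-2 ^ 4 * 3) 1 3)).add (h (2 ^ 4) 2 2) using 1
  simp only [map_mul, map_neg, map_pow, map_ofNat]
  ring

theorem isBihomogeneous_c6 : IsBihomogeneous 0 3 (c6 k) := by
  refine of_C ?_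
  have h (c : k) (i j l : Fin 5) : (C c * X i * X j * X l : CoeffRing k).IsHomogeneous 3 := by
    simpa using (((isHomogeneous_C _ c).mul (isHomogeneous_X k i)).mul (isHomogeneous_X k j)).mul
      (isHomogeneous_X k l)
  convert ((((h (2 ^ 5 * 72) 0 2 4).add (h (-2 ^ 5 * 27) 0 3 3)).add
    (h (-2 ^ 5 * 27) 1 1 4)).add (h (2 ^ 5 * 9) 1 2 3)).add (h (-2 ^ 5 * 2) 2 2 2) using 1
  simp only [map_mul, map_neg, map_pow, map_ofNat]
  ring

theorem isBihomogeneous_H : IsBihomogeneous 4 2 (H k) := by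
  refine smul ?_ _
  rw [Matrix.det_fin_two]
  have h (i j : Fin 2) := (isBihomogeneous_U (k := k).pderiv j).pderiv i
  exact ((h 0 0).mul (h 1 1)).sub ((h 0 1).mul (h 1 0))

theorem isBihomogeneous_J : IsBihomogeneous 6 3 (J k) :=
  ((((isBihomogeneous_U).pderiv 0).mul (isBihomogeneous_H.pderiv 1)).sub
    ((isBihomogeneous_U.pderiv 1).mul (isBihomogeneous_H.pderiv 0))).smul _

/-! ### Covariant columns and their module structure. -/

theorem inv_apply (g : GL (Fin 2) (AlgebraicClosure k)) (i j : Fin 2) :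
    (((g⁻¹ : GL (Fin 2) (AlgebraicClosure k)) : Matrix (Fin 2) (Fin 2) (AlgebraicClosure k)) i j) =
      (Matrix.det (g : Matrix (Fin 2) (Fin 2) (AlgebraicClosure k)))⁻¹ *
        !![g 1 1, -g 0 1; -g 1 0, g 0 0] i j := by
  rw [Matrix.coe_units_inv, Matrix.inv_def, Matrix.adjugate_fin_two, Ring.inverse_eq_inv']
  rfl

theorem isCovariantColumn_xColumn : IsCovariantColumn 1 0 0 (xColumn k) where
  order i := by fin_cases i <;> exact (of_X _).order
  degree i s := by fin_cases i <;> exact (of_X _).degree s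
  equivariant g u i := by
    have h := det_ne_zero g
    have hi : C (Matrix.det (g : Matrix (Fin 2) (Fin 2) (AlgebraicClosure k)))⁻¹ *
        (C (g 0 0) * C (g 1 1) - C (g 0 1) * C (g 1 0)) =
        (1 : MvPolynomial (Fin 2) (AlgebraicClosure k)) := by
      rw [← C_mul, ← C_mul, ← C_sub, ← Matrix.det_fin_two, ← C_mul, inv_mul_cancel₀ h, C_1]
    rw [Fin.sum_univ_two, inv_apply, inv_apply, zpow_zero, C_1, one_mul]
    fin_cases i
    · simp only [xColumn, Fin.zero_eta, Matrix.cons_val, atQuartic_X, comp_X, Matrix.of_apply,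
        C_mul, C_neg]
      linear_combination (-X 0) * hi
    · simp only [xColumn, Fin.mk_one, Matrix.cons_val, atQuartic_X, comp_X, Matrix.of_apply,
        C_mul, C_neg]
      linear_combination (-X 1) * hi

/-- The gradient transforms by `gᵀ`, and the quarter turn in `del` conjugates `gᵀ` into `adj g =
(det g) g⁻¹`; hence the weight goes up by one. -/
theorem isCovariantColumn_del {m d : ℕ} {p : ℤ} {F : FormRing k} (hF : IsBihomogeneous m d F)
    (hp : IsEquivariant p F) : IsCovariantColumn (m - 1) d (p + 1) (del F) where
  order i := by
    fin_cases i
    · exact (hF.pderiv 1).neg.order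
    · exact (hF.pderiv 0).order
  degree i := by
    fin_cases i
    · exact (hF.pderiv 1).neg.degree
    · exact (hF.pderiv 0).degree
  equivariant g u i := by
    have h := det_ne_zero g
    have hi : C ((Matrix.det (g : Matrix (Fin 2) (Fin 2) (AlgebraicClosure k))) ^ (p + 1)) *
        C (Matrix.det (g : Matrix (Fin 2) (Fin 2) (AlgebraicClosure k)))⁻¹ =
        (C ((Matrix.det (g : Matrix (Fin 2) (Fin 2) (AlgebraicClosure k))) ^ p) :
          MvPolynomial (Fin 2) (AlgebraicClosure k)) := by
      rw [← C_mul, zpow_add_one₀ h, mul_assoc, mul_inv_cancel₀ h, mul_one]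
    rw [Fin.sum_univ_two, inv_apply, inv_apply]
    simp only [C_mul]
    fin_cases i
    · simp only [del, Fin.zero_eta, Matrix.cons_val, Matrix.of_apply,
        C_neg, atQuartic_neg, comp_neg, hp.atQuartic_pderiv, ← hi]
      ring
    · simp only [del, Fin.mk_one, Matrix.cons_val, Matrix.of_apply,
        C_neg, atQuartic_neg, comp_neg, hp.atQuartic_pderiv, ← hi]
      ring

theorem IsCovariantColumn.mul {m d m' d' : ℕ} {p q : ℤ} {F : FormRing k} {v : Column k}
    (hF : IsBihomogeneous m d F) (hp : IsEquivariant p F) (hv : IsCovariantColumn m' d' q v) :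
    IsCovariantColumn (m + m') (d + d') (p + q) (F • v) where
  order i := hF.order.mul (hv.order i)
  degree i := (hF.mul ⟨hv.order i, hv.degree i⟩).degree
  equivariant g u i := by
    simp only [Pi.smul_apply, smul_eq_mul, atQuartic_mul, comp_mul]
    rw [hp g u, hv.equivariant g u i, zpow_add₀ (det_ne_zero g), C_mul, Fin.sum_univ_two,
      Fin.sum_univ_two]
    ring

/-- The span of the covariant columns whose weight satisfies `P` is closed under multiplication by
`k[c₄, c₆, U, H]` if `P` is closed under adding even numbers. -/
theorem smul_mem_span {P : ℤ → Prop} (hP : ∀ p q, Even p → P q → P (p + q))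
    {F : FormRing k} (hF : F ∈ scalarRing k) {v : Column k}
    (hv : v ∈ Submodule.span k {v | ∃ (m d : ℕ) (p : ℤ), P p ∧ IsCovariantColumn m d p v}) :
    F • v ∈ Submodule.span k {v | ∃ (m d : ℕ) (p : ℤ), P p ∧ IsCovariantColumn m d p v} := by
  have key {m d : ℕ} {p : ℤ} {G : FormRing k} (hp : Even p) (hG : IsBihomogeneous m d G)
      (hG' : IsEquivariant p G) {w : Column k}
      (hw : w ∈ Submodule.span k {v | ∃ (m d : ℕ) (p : ℤ), P p ∧ IsCovariantColumn m d p v}) :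
      G • w ∈ Submodule.span k {v | ∃ (m d : ℕ) (p : ℤ), P p ∧ IsCovariantColumn m d p v} := by
    induction hw using Submodule.span_induction with
    | mem w hw =>
      obtain ⟨m', d', q, hq, hw⟩ := hw
      exact Submodule.subset_span ⟨_, _, _, hP p q hp hq, hw.mul hG hG'⟩
    | zero => rw [smul_zero]; exact zero_mem _
    | add w w' _ _ h h' => rw [smul_add]; exact add_mem h h'
    | smul c w _ h => rw [smul_comm]; exact Submodule.smul_mem _ _ h
  induction hF using Algebra.adjoin_induction generalizing v with
  | mem G hG =>
    rcases hG with rfl | rfl | rfl | rfl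
    · exact key (by decide) isBihomogeneous_c4 isEquivariant_c4 hv
    · exact key (by decide) isBihomogeneous_c6 isEquivariant_c6 hv
    · exact key (by decide) isBihomogeneous_U isEquivariant_U hv
    · exact key (by decide) isBihomogeneous_H isEquivariant_H hv
  | algebraMap c => rw [algebraMap_smul]; exact Submodule.smul_mem _ _ hv
  | add F G _ _ hF hG => rw [add_smul]; exact add_mem (hF hv) (hG hv)
  | mul F G _ _ hF hG => rw [mul_smul]; exact hF (hG hv)

/-! ### Leading coefficients. -/

/-- The value of a form at `x = (1, 0)`, that is, its leading coefficient. -/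
def lead : FormRing k →ₐ[k] CoeffRing k :=
  (aeval ![1, 0] : FormRing k →ₐ[CoeffRing k] CoeffRing k).restrictScalars k

theorem lead_C (f : CoeffRing k) : lead (C f) = f := by simp [lead]

theorem lead_X_zero : lead (X 0 : FormRing k) = 1 := by simp [lead]

theorem lead_X_one : lead (X 1 : FormRing k) = 0 := by simp [lead]

theorem two_ne_zero_algebraicClosure (h2 : (2 : k) ≠ 0) : (2 : AlgebraicClosure k) ≠ 0 := by
  rw [← map_ofNat (algebraMap k (AlgebraicClosure k)) 2]
  exact (map_ne_zero _).mpr h2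

theorem three_ne_zero_algebraicClosure (h3 : (3 : k) ≠ 0) : (3 : AlgebraicClosure k) ≠ 0 := by
  rw [← map_ofNat (algebraMap k (AlgebraicClosure k)) 3]
  exact (map_ne_zero _).mpr h3

theorem three_ne_zero_of_ringChar (h3 : ringChar k ≠ 3) : (3 : k) ≠ 0 := by
  intro h
  have hd : ringChar k ∣ 3 := ringChar.dvd (by exact_mod_cast h)
  rcases (Nat.dvd_prime Nat.prime_three).mp hd with h1 | h1
  · exact CharP.ringChar_ne_one h1
  · exact h3 h1

theorem H_eq (h3 : (3 : k) ≠ 0) : H k =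
    C (8 * X 0 * X 2 - 3 * X 1 ^ 2) * X 0 ^ 4 + C (24 * X 0 * X 3 - 4 * X 1 * X 2) * X 0 ^ 3 * X 1
      + C (48 * X 0 * X 4 + 6 * X 1 * X 3 - 4 * X 2 ^ 2) * X 0 ^ 2 * X 1 ^ 2
      + C (24 * X 1 * X 4 - 4 * X 2 * X 3) * X 0 * X 1 ^ 3
      + C (8 * X 2 * X 4 - 3 * X 3 ^ 2) * X 1 ^ 4 := by
  rw [H, inv_smul_eq_iff₀ h3, smul_eq_C_C_mul, Matrix.det_fin_two, U, quartic_eq]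
  simp only [Matrix.of_apply, map_add, map_sub, map_mul, map_pow, Derivation.leibniz,
    Derivation.leibniz_pow, pderiv_C, pderiv_X, Pi.single_apply, smul_eq_mul, nsmul_eq_mul,
    map_ofNat, Derivation.map_natCast]
  simp
  ring

theorem lead_U : lead (U k) = X 0 := by
  simp [U, quartic_eq, lead]

theorem lead_H (h3 : (3 : k) ≠ 0) : lead (H k) = 8 * X 0 * X 2 - 3 * X 1 ^ 2 := by
  simp [H_eq h3, lead]

theorem lead_J (h2 : (2 : k) ≠ 0) (h3 : (3 : k) ≠ 0) :
    lead (J k) = 8 * X 0 ^ 2 * X 3 - 4 * X 0 * X 1 * X 2 + X 1 ^ 3 := by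
  have h12 : (12 : k) ≠ 0 := by
    rw [show (12 : k) = 2 * 2 * 3 by norm_num]
    exact mul_ne_zero (mul_ne_zero h2 h2) h3
  rw [J, map_smul, inv_smul_eq_iff₀ h12, H_eq h3, U, quartic_eq]
  simp [lead, pderiv_X, smul_eq_C_mul, Derivation.leibniz, Derivation.leibniz_pow]
  rw [show (C 12 : CoeffRing k) = 12 from map_ofNat _ _]
  ring

theorem lead_c4 : lead (c4 k) = 2 ^ 4 * (12 * X 0 * X 4 - 3 * X 1 * X 3 + X 2 ^ 2) := lead_C _

theorem lead_c6 : lead (c6 k) = 2 ^ 5 * (72 * X 0 * X 2 * X 4 - 27 * X 0 * X 3 ^ 2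
    - 27 * X 1 ^ 2 * X 4 + 9 * X 1 * X 2 * X 3 - 2 * X 2 ^ 3) := lead_C _

/-- A polynomial that vanishes on all points over the algebraic closure is zero. -/
theorem eq_zero_of_forall_aeval_eq_zero {σ : Type*} {f : MvPolynomial σ k}
    (h : ∀ y : σ → AlgebraicClosure k, aeval y f = 0) : f = 0 := by
  have h0 : map (algebraMap k (AlgebraicClosure k)) f = 0 := by
    refine MvPolynomial.funext fun y => ?_
    rw [eval_map, ← aeval_def, h, map_zero]
  exact (map_eq_zero_iff _ (map_injective _ (algebraMap k (AlgebraicClosure k)).injective)).mp h0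

/-! ### Polynomials in the generators, and their restriction to `a = 0`. -/

/-- The parametrization of `k[c₄, c₆, U, H]` by polynomials in four variables. -/
def scalarHom (k : Type*) [Field k] : MvPolynomial (Fin 4) k →ₐ[k] FormRing k :=
  aeval ![c4 k, c6 k, U k, H k]

theorem scalarHom_mem (P : MvPolynomial (Fin 4) k) : scalarHom k P ∈ scalarRing k := by
  have h : scalarRing k = (scalarHom k).range := by
    rw [scalarRing, scalarHom, ← Algebra.adjoin_range_eq_range_aeval]
    congr 1
    ext F
    simp
    generalize c4 k = a, c6 k = b, U k = c, H k = d
    tauto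
  rw [h]
  exact ⟨P, rfl⟩

theorem lead_scalarHom_C (a : k) : lead (scalarHom k (C a)) = C a := by
  rw [scalarHom, aeval_C]
  exact lead.commutes a

theorem lead_scalarHom_X (i : Fin 4) :
    lead (scalarHom k (X i)) = lead (![c4 k, c6 k, U k, H k] i) := by
  rw [scalarHom, aeval_X]

theorem aeval_lead_scalarHom (P : MvPolynomial (Fin 4) k) (u : Fin 5 → AlgebraicClosure k) :
    aeval u (lead (scalarHom k P)) =
      aeval ![aeval u (lead (c4 k)), aeval u (lead (c6 k)), aeval u (lead (U k)),
        aeval u (lead (H k))] P := by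
  rw [scalarHom, ← AlgHom.comp_apply, ← AlgHom.comp_apply, comp_aeval]
  congr 2
  ext i
  fin_cases i <;> rfl

/-- On the quartics with `a = 0` and `b ≠ 0` the values of `c₄`, `c₆` and the leading coefficient
of `H` are arbitrary, except that the last one does not vanish. -/
theorem exists_quartic_of_values (h2 : (2 : k) ≠ 0) (h3 : (3 : k) ≠ 0)
    (y : Fin 4 → AlgebraicClosure k) (hy2 : y 2 = 0) (hy3 : y 3 ≠ 0) :
    ∃ u : Fin 5 → AlgebraicClosure k, u 0 = 0 ∧ u 1 ≠ 0 ∧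
      ![aeval u (lead (c4 k)), aeval u (lead (c6 k)), aeval u (lead (U k)),
        aeval u (lead (H k))] = y := by
  have h2' : (2 : AlgebraicClosure k) ≠ 0 := two_ne_zero_algebraicClosure h2
  have h3' : (3 : AlgebraicClosure k) ≠ 0 := three_ne_zero_algebraicClosure h3
  have h48 : (48 : AlgebraicClosure k) ≠ 0 := by
    rw [show (48 : AlgebraicClosure k) = 2 ^ 4 * 3 by norm_num]
    exact mul_ne_zero (pow_ne_zero _ h2') h3'
  have h864 : (864 : AlgebraicClosure k) ≠ 0 := by
    rw [show (864 : AlgebraicClosure k) = 2 ^ 5 * 3 ^ 3 by norm_num]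
    exact mul_ne_zero (pow_ne_zero _ h2') (pow_ne_zero _ h3')
  obtain ⟨b, hb⟩ := IsAlgClosed.exists_pow_nat_eq (-y 3 / 3) zero_lt_two
  have hb0 : b ≠ 0 := by
    rintro rfl
    have : -y 3 / 3 = 0 := by rw [← hb]; simp
    simp [hy3, h3'] at this
  -- With `a = c = 0` the values are `c₄ = -48 b d`, `c₆ = -864 b² e` and `H₀ = -3 b²`, which can be
  -- solved for `b`, `d`, `e` in turn.
  refine ⟨![0, b, 0, -y 0 / (48 * b), -y 1 / (864 * b ^ 2)], rfl, hb0, ?_⟩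
  rw [lead_c4, lead_c6, lead_U, lead_H h3]
  ext i
  fin_cases i
  · simp
    field_simp
    ring
  · simp
    field_simp
    ring
  · simp [hy2]
  · simp [hb]
    field_simp

/-- Division by the variable `X 2`, which stands for `U`; the remainder is obtained by setting this
variable to zero. -/
theorem exists_eq_X_mul_add (Q : MvPolynomial (Fin 4) k) :
    ∃ Q', Q = X 2 * Q' + aeval ![X 0, X 1, 0, X 3] Q := by
  induction Q using MvPolynomial.induction_on with
  | C a => exact ⟨0, by simp⟩
  | add P Q hP hQ =>
    obtain ⟨P', hP⟩ := hP
    obtain ⟨Q', hQ⟩ := hQ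
    exact ⟨P' + Q', by rw [map_add]; linear_combination hP + hQ⟩
  | mul_X P i hP =>
    obtain ⟨P', hP⟩ := hP
    rw [map_mul, aeval_X]
    fin_cases i
    · exact ⟨P' * X 0, by
        change P * X 0 = X 2 * (P' * X 0) + _ * X 0
        linear_combination hP * X 0⟩
    · exact ⟨P' * X 1, by
        change P * X 1 = X 2 * (P' * X 1) + _ * X 1
        linear_combination hP * X 1⟩
    · exact ⟨P, by
        change P * X 2 = X 2 * P + _ * 0
        ring⟩
    · exact ⟨P' * X 3, by
        change P * X 3 = X 2 * (P' * X 3) + _ * X 3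
        linear_combination hP * X 3⟩

/-- On `a = 0`, `b ≠ 0` the triple `(c₄, c₆, H₀)` takes all values with `H₀ ≠ 0`, so the remainder
of `Q` modulo `X 2` vanishes identically. -/
theorem X_dvd_of_lead_scalarHom_eq_zero (h2 : (2 : k) ≠ 0) (h3 : (3 : k) ≠ 0)
    {Q : MvPolynomial (Fin 4) k}
    (h : ∀ u : Fin 5 → AlgebraicClosure k, u 0 = 0 → u 1 ≠ 0 →
      aeval u (lead (scalarHom k Q)) = 0) : ∃ Q', Q = X 2 * Q' := by
  obtain ⟨Q', hQ⟩ := exists_eq_X_mul_add Q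
  refine ⟨Q', ?_⟩
  -- The factor `X 3` disposes of the points with `H₀ = 0`, which are not attained.
  have h0 : aeval ![X 0, X 1, 0, X 3] Q * X 3 = (0 : MvPolynomial (Fin 4) k) := by
    refine eq_zero_of_forall_aeval_eq_zero fun y => ?_
    rw [map_mul, aeval_X]
    by_cases hy : y 3 = 0
    · rw [hy, mul_zero]
    obtain ⟨u, hu0, hu1, hu⟩ := exists_quartic_of_values h2 h3 ![y 0, y 1, 0, y 3] rfl hy
    have h1 := h u hu0 hu1
    rw [aeval_lead_scalarHom, hu] at h1
    rw [← AlgHom.comp_apply, comp_aeval, ← h1]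
    have : (fun i => aeval y (![X 0, X 1, 0, X 3] i : MvPolynomial (Fin 4) k)) =
        ![y 0, y 1, 0, y 3] := by
      ext i
      fin_cases i <;> simp
    rw [this, h1, zero_mul]
  rw [(mul_eq_zero.mp h0).resolve_right (X_ne_zero 3), add_zero] at hQ
  exact hQ

/-! ### Reduction to quartics without cubic term; odd seminvariants. -/

/-- The coefficients of the quartic that arises from `u` by the translation
`x₁ ↦ x₁ - u₁ / (4 u₀) x₂`. -/
def depressed (k : Type*) [Field k] (u : Fin 5 → AlgebraicClosure k) : Fin 5 → AlgebraicClosure k :=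
  ![u 0, 0, aeval u (lead (H k)) / (8 * u 0), aeval u (lead (J k)) / (8 * u 0 ^ 2),
    (4 * u 0 ^ 2 * aeval u (lead (c4 k)) - aeval u (lead (H k)) ^ 2) / (768 * u 0 ^ 3)]

theorem depressed_eq (h2 : (2 : k) ≠ 0) (h3 : (3 : k) ≠ 0) (u : Fin 5 → AlgebraicClosure k)
    (hu : u 0 ≠ 0) : depressed k u = substCoeffs u 1 (-u 1 / (4 * u 0)) 0 1 := by
  have h2' : (2 : AlgebraicClosure k) ≠ 0 := two_ne_zero_algebraicClosure h2
  have h3' : (3 : AlgebraicClosure k) ≠ 0 := three_ne_zero_algebraicClosure h3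
  have h4 : (4 : AlgebraicClosure k) ≠ 0 := by
    rw [show (4 : AlgebraicClosure k) = 2 ^ 2 by norm_num]
    exact pow_ne_zero _ h2'
  have h8 : (8 : AlgebraicClosure k) ≠ 0 := by
    rw [show (8 : AlgebraicClosure k) = 2 ^ 3 by norm_num]
    exact pow_ne_zero _ h2'
  have h768 : (768 : AlgebraicClosure k) ≠ 0 := by
    rw [show (768 : AlgebraicClosure k) = 2 ^ 8 * 3 by norm_num]
    exact mul_ne_zero (pow_ne_zero _ h2') h3'
  rw [depressed, lead_H h3, lead_J h2 h3, lead_c4]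
  ext i
  fin_cases i <;> simp [substCoeffs] <;> field_simp <;> ring

/-- The syzygy `27 J² = 3 c₄ U² H - H³ - 2 c₆ U³`, read off at `(1, 0)`. -/
theorem lead_J_sq (h2 : (2 : k) ≠ 0) (h3 : (3 : k) ≠ 0) : lead (J k) ^ 2 =
    lead (scalarHom k (C 27⁻¹ * (3 * X 0 * X 2 ^ 2 * X 3 - X 3 ^ 3 - 2 * X 1 * X 2 ^ 3))) := by
  have h27 : (C 27⁻¹ * 27 : CoeffRing k) = 1 := by
    have : (27 : k) ≠ 0 := by
      rw [show (27 : k) = 3 ^ 3 by norm_num]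
      exact pow_ne_zero _ h3
    rw [show (27 : CoeffRing k) = C 27 from (map_ofNat C 27).symm, ← C_mul, inv_mul_cancel₀ this, C_1]
  simp only [map_mul, map_sub, map_pow, map_ofNat, lead_scalarHom_C, lead_scalarHom_X,
    Matrix.cons_val, lead_U, lead_H h3, lead_c4, lead_c6, lead_J h2 h3]
  linear_combination (-(8 * X 0 ^ 2 * X 3 - 4 * X 0 * X 1 * X 2 + X 1 ^ 3) ^ 2) * h27

/-- Every coefficient of the depressed quartic is, after multiplication by a power of `a`, of the
form `P + J₀ Q`; by the syzygy for `J₀²` such expressions are closed under products. -/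
theorem exists_pow_mul_depressed (h2 : (2 : k) ≠ 0) (h3 : (3 : k) ≠ 0) (f : CoeffRing k) :
    ∃ (N : ℕ) (P Q : MvPolynomial (Fin 4) k), ∀ u : Fin 5 → AlgebraicClosure k, u 0 ≠ 0 →
      u 0 ^ N * aeval (depressed k u) f =
        aeval u (lead (scalarHom k P) + lead (J k) * lead (scalarHom k Q)) := by
  induction f using MvPolynomial.induction_on with
  | C a => exact ⟨0, C a, 0, fun u hu => by simp [lead_C]⟩
  | add f g hf hg =>
    obtain ⟨N, P, Q, hf⟩ := hf
    obtain ⟨M, P', Q', hg⟩ := hg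
    refine ⟨N + M, X 2 ^ M * P + X 2 ^ N * P', X 2 ^ M * Q + X 2 ^ N * Q', fun u hu => ?_⟩
    have h1 := hf u hu
    have h2 := hg u hu
    have hU : aeval u (lead (scalarHom k (X 2))) = u 0 := by simp [scalarHom, lead_U]
    simp only [map_add, map_mul, map_pow, hU] at h1 h2 ⊢
    linear_combination u 0 ^ M * h1 + u 0 ^ N * h2
  | mul_X f i hf =>
    obtain ⟨N, P, Q, hf⟩ := hf
    have hX : ∃ (M : ℕ) (P' Q' : MvPolynomial (Fin 4) k), ∀ u : Fin 5 → AlgebraicClosure k,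
        u 0 ≠ 0 → u 0 ^ M * depressed k u i =
          aeval u (lead (scalarHom k P') + lead (J k) * lead (scalarHom k Q')) := by
      have h2' : (2 : AlgebraicClosure k) ≠ 0 := two_ne_zero_algebraicClosure h2
      have h3' : (3 : AlgebraicClosure k) ≠ 0 := three_ne_zero_algebraicClosure h3
      have h8 : (8 : AlgebraicClosure k) ≠ 0 := by
        rw [show (8 : AlgebraicClosure k) = 2 ^ 3 by norm_num]
        exact pow_ne_zero _ h2'
      have h768 : (768 : AlgebraicClosure k) ≠ 0 := by
        rw [show (768 : AlgebraicClosure k) = 2 ^ 8 * 3 by norm_num]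
        exact mul_ne_zero (pow_ne_zero _ h2') h3'
      fin_cases i
      · exact ⟨0, X 2, 0, fun u hu => by simp [scalarHom, depressed, lead_U]⟩
      · exact ⟨0, 0, 0, fun u hu => by simp [depressed]⟩
      · refine ⟨1, C 8⁻¹ * X 3, 0, fun u hu => ?_⟩
        simp only [map_add, map_mul, map_ofNat, map_zero, lead_scalarHom_C, lead_scalarHom_X,
          Matrix.cons_val, depressed, aeval_C, map_inv₀]
        simp
        field_simp
      · refine ⟨2, 0, C 8⁻¹, fun u hu => ?_⟩
        simp only [map_add, map_mul, map_ofNat, map_zero, lead_scalarHom_C, depressed, aeval_C, map_inv₀]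
        simp
        field_simp
      · refine ⟨3, C 768⁻¹ * (4 * X 2 ^ 2 * X 0 - X 3 ^ 2), 0, fun u hu => ?_⟩
        simp only [map_add, map_mul, map_sub, map_pow, map_ofNat, map_zero, lead_scalarHom_C,
          lead_scalarHom_X, Matrix.cons_val, depressed, lead_U, aeval_X, aeval_C, map_inv₀]
        simp
        field_simp
    obtain ⟨M, P', Q', hX⟩ := hX
    -- The product `(P + J₀ Q)(P' + J₀ Q')`, with `J₀²` replaced by means of the syzygy.
    refine ⟨N + M, P * P' + C 27⁻¹ * (3 * X 0 * X 2 ^ 2 * X 3 - X 3 ^ 3 - 2 * X 1 * X 2 ^ 3) *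
      (Q * Q'), P * Q' + Q * P', fun u hu => ?_⟩
    have hJ := congrArg (aeval u) (lead_J_sq h2 h3)
    have h1 := hf u hu
    have h2 := hX u hu
    rw [map_add (scalarHom k), map_mul (scalarHom k) (_ * _) (Q * Q'), map_add lead,
      map_mul lead _ (scalarHom k (Q * Q'))]
    simp only [map_add (aeval u), map_mul (aeval u), map_pow (aeval u)] at hJ h1 h2 ⊢
    rw [← hJ]
    simp only [map_add, map_mul, aeval_X] at h1 h2 ⊢
    rw [pow_add]
    linear_combination (u 0 ^ M * depressed k u i) * h1 +
      (aeval u (lead (scalarHom k P)) + aeval u (lead (J k)) * aeval u (lead (scalarHom k Q))) * h2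

/-- The seminvariants that are odd under `(b, d) ↦ (-b, -d)` are the multiples of the leading
coefficient of `J` by elements of `k[c₄, c₆, U, H]`. -/
theorem exists_eq_lead_J_mul (h2 : (2 : k) ≠ 0) (h3 : (3 : k) ≠ 0) {f : CoeffRing k}
    (hT : ∀ (t : AlgebraicClosure k) (u : Fin 5 → AlgebraicClosure k),
      aeval (substCoeffs u 1 t 0 1) f = aeval u f)
    (hS : ∀ u : Fin 5 → AlgebraicClosure k, aeval (substCoeffs u 1 0 0 (-1)) f = -aeval u f) :
    ∃ Q : MvPolynomial (Fin 4) k, f = lead (J k) * lead (scalarHom k Q) := by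
  have h2' : (2 : AlgebraicClosure k) ≠ 0 := two_ne_zero_algebraicClosure h2
  obtain ⟨N, P, Q, hf⟩ := exists_pow_mul_depressed h2 h3 f
  have hs (u : Fin 5 → AlgebraicClosure k) :
      substCoeffs u 1 0 0 (-1) = ![u 0, -u 1, u 2, -u 3, u 4] := by
    ext i
    fin_cases i <;> simp [substCoeffs] <;> ring
  have hA (R : MvPolynomial (Fin 4) k) (u : Fin 5 → AlgebraicClosure k) :
      aeval (substCoeffs u 1 0 0 (-1)) (lead (scalarHom k R)) = aeval u (lead (scalarHom k R)) := by
    rw [aeval_lead_scalarHom, aeval_lead_scalarHom, hs, lead_c4, lead_c6, lead_U, lead_H h3]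
    congr 2
    ext i
    fin_cases i <;> simp
  have hJ (u : Fin 5 → AlgebraicClosure k) :
      aeval (substCoeffs u 1 0 0 (-1)) (lead (J k)) = -aeval u (lead (J k)) := by
    rw [hs, lead_J h2 h3]
    simp
    ring
  have hQ : X 0 ^ N * f = lead (J k) * lead (scalarHom k Q) := by
    rw [← sub_eq_zero]
    -- The extra factor `X 0` restricts the check to quartics with `a ≠ 0`, where the depressed form
    -- exists.
    have : X 0 * (X 0 ^ N * f - lead (J k) * lead (scalarHom k Q)) = 0 := by
      refine eq_zero_of_forall_aeval_eq_zero fun u => ?_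
      rw [map_mul, aeval_X]
      by_cases hu : u 0 = 0
      · rw [hu, zero_mul]
      -- Comparing the identity at `u` and at its mirror image: `P` and `Q` are even, `f` and `J₀`
      -- are odd, so the difference loses `P` and leaves twice the claim.
      have e1 := hf u hu
      have e2 := hf (substCoeffs u 1 0 0 (-1)) (by rw [hs]; exact hu)
      rw [depressed_eq h2 h3 _ hu, hT] at e1
      rw [depressed_eq h2 h3 _ (by rw [hs]; exact hu), hT, hS] at e2
      simp only [map_add, map_mul, hA, hJ] at e1 e2
      rw [hs] at e2
      simp only [Matrix.cons_val] at e2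
      simp only [map_sub, map_mul, map_pow, aeval_X]
      have : (2 : AlgebraicClosure k) * (u 0 ^ N * aeval u f -
          aeval u (lead (J k)) * aeval u (lead (scalarHom k Q))) = 0 := by
        linear_combination e1 - e2
      rw [(mul_eq_zero.mp this).resolve_left h2', mul_zero]
    exact (mul_eq_zero.mp this).resolve_left (X_ne_zero 0)
  clear hf
  induction N generalizing Q with
  | zero => exact ⟨Q, by simpa using hQ⟩
  | succ N ih =>
    -- At `a = 0` the left side vanishes and `J₀ = b³ ≠ 0`, so `Q` vanishes there and one factor `a`
    -- can be cancelled.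
    obtain ⟨Q', rfl⟩ := X_dvd_of_lead_scalarHom_eq_zero h2 h3 (Q := Q) fun u hu0 hu1 => by
      have e := congrArg (aeval u) hQ
      rw [lead_J h2 h3] at e
      simpa [hu0, hu1] using e
    refine ih Q' (mul_left_cancel₀ (X_ne_zero (R := k) (0 : Fin 5)) ?_)
    have hX : lead (scalarHom k (X 2)) = X 0 := by simp [scalarHom, lead_U]
    rw [map_mul, map_mul, hX] at hQ
    linear_combination hQ

/-! ### Scalar covariants of odd weight. -/

/-- `F (U ∘ g; x) = (det g) ^ e F (U; g x)` for all `g` of determinant `1` or `-1`, as an identity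
between values at points over the algebraic closure. -/
def IsSemiinvariant (e : ℕ) (F : FormRing k) : Prop :=
  ∀ g : Matrix (Fin 2) (Fin 2) (AlgebraicClosure k), g.det ^ 2 = 1 →
    ∀ (u : Fin 5 → AlgebraicClosure k) (x : Fin 2 → AlgebraicClosure k),
      eval x (atQuartic F (compCoeffs u g)) = g.det ^ e * eval (g.mulVec x) (atQuartic F u)

theorem IsSemiinvariant.mul {e e' : ℕ} {F G : FormRing k} (hF : IsSemiinvariant e F)
    (hG : IsSemiinvariant e' G) : IsSemiinvariant (e + e') (F * G) := by
  intro g hg u x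
  rw [atQuartic_mul, atQuartic_mul, map_mul, map_mul, hF g hg, hG g hg, pow_add]
  ring

theorem IsSemiinvariant.add {e : ℕ} {F G : FormRing k} (hF : IsSemiinvariant e F)
    (hG : IsSemiinvariant e G) : IsSemiinvariant e (F + G) := by
  intro g hg u x
  rw [atQuartic_add, atQuartic_add, map_add, map_add, hF g hg, hG g hg, mul_add]

theorem zpow_even_of_sq_eq_one {K : Type*} [Field K] {δ : K} (h : δ ^ 2 = 1) {p : ℤ}
    (hp : Even p) : δ ^ p = 1 := by
  obtain ⟨r, rfl⟩ := hp
  rw [← two_mul, zpow_mul, zpow_ofNat, h, one_zpow]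

theorem zpow_odd_of_sq_eq_one {K : Type*} [Field K] {δ : K} (h : δ ^ 2 = 1) {p : ℤ}
    (hp : Odd p) : δ ^ p = δ := by
  obtain ⟨r, rfl⟩ := hp
  have h0 : δ ≠ 0 := by rintro rfl; simp at h
  rw [zpow_add_one₀ h0, zpow_mul, zpow_ofNat, h, one_zpow, one_mul]

theorem IsEquivariant.eval_atQuartic {p : ℤ} {F : FormRing k} (hF : IsEquivariant p F)
    {g : Matrix (Fin 2) (Fin 2) (AlgebraicClosure k)} (hg : g.det ^ 2 = 1)
    (u : Fin 5 → AlgebraicClosure k) (x : Fin 2 → AlgebraicClosure k) :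
    eval x (atQuartic F (compCoeffs u g)) = g.det ^ p * eval (g.mulVec x) (atQuartic F u) := by
  have h0 : g.det ≠ 0 := by intro h; simp [h] at hg
  have h := congrArg (eval x) (hF (Matrix.GeneralLinearGroup.mkOfDetNeZero g h0) u)
  rw [map_mul, eval_C, eval_comp] at h
  exact h

theorem IsEquivariant.isSemiinvariant_zero {p : ℤ} {F : FormRing k} (hF : IsEquivariant p F)
    (hp : Even p) : IsSemiinvariant 0 F := fun g hg u x => by
  rw [hF.eval_atQuartic hg, zpow_even_of_sq_eq_one hg hp, pow_zero]

theorem IsEquivariant.isSemiinvariant_one {p : ℤ} {F : FormRing k} (hF : IsEquivariant p F)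
    (hp : Odd p) : IsSemiinvariant 1 F := fun g hg u x => by
  rw [hF.eval_atQuartic hg, zpow_odd_of_sq_eq_one hg hp, pow_one]

theorem isSemiinvariant_of_mem_scalarRing {F : FormRing k} (hF : F ∈ scalarRing k) :
    IsSemiinvariant 0 F := by
  induction hF using Algebra.adjoin_induction with
  | mem G hG =>
    rcases hG with rfl | rfl | rfl | rfl
    · exact isEquivariant_c4.isSemiinvariant_zero (by decide)
    · exact isEquivariant_c6.isSemiinvariant_zero (by decide)
    · exact isEquivariant_U.isSemiinvariant_zero (by decide)
    · exact isEquivariant_H.isSemiinvariant_zero (by decide)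
  | algebraMap c =>
    intro g _ u x
    rw [Algebra.algebraMap_eq_smul_one, smul_eq_C_C_mul, mul_one, atQuartic_C, atQuartic_C]
    simp
  | add F G _ _ hF hG => exact hF.add hG
  | mul F G _ _ hF hG => exact hF.mul hG

theorem eval_atQuartic_lead (F : FormRing k) (u : Fin 5 → AlgebraicClosure k) :
    eval ![1, 0] (atQuartic F u) = aeval u (lead F) := by
  induction F using MvPolynomial.induction_on with
  | C a => rw [atQuartic_C, eval_C, lead_C]
  | add F G hF hG => rw [atQuartic_add, map_add, hF, hG, map_add, map_add]
  | mul_X F i hF =>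
    rw [atQuartic_mul, map_mul, hF, map_mul, map_mul, atQuartic_X, eval_X]
    fin_cases i
    · simp [lead_X_zero]
    · simp [lead_X_one]

theorem eq_zero_of_forall_eval_atQuartic {F : FormRing k}
    (h : ∀ (u : Fin 5 → AlgebraicClosure k) (x : Fin 2 → AlgebraicClosure k),
      eval x (atQuartic F u) = 0) : F = 0 := by
  ext1 s
  rw [coeff_zero]
  refine eq_zero_of_forall_aeval_eq_zero fun u => ?_
  have hu : atQuartic F u = 0 := MvPolynomial.funext fun x => by rw [h, map_zero]
  have hs := congrArg (coeff s) hu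
  rw [atQuartic, coeff_map, coeff_zero] at hs
  exact hs

/-- A semiinvariant form is determined by its leading coefficient. -/
theorem IsSemiinvariant.eq_of_lead_eq {e : ℕ} {F G : FormRing k} (hF : IsSemiinvariant e F)
    (hG : IsSemiinvariant e G) (h : lead F = lead G) : F = G := by
  rw [← sub_eq_zero]
  have h0 : X 0 * (F - G) = 0 := by
    refine eq_zero_of_forall_eval_atQuartic fun u x => ?_
    rw [atQuartic_mul, atQuartic_X, map_mul, eval_X, atQuartic_sub, map_sub]
    by_cases hx : x 0 = 0
    · rw [hx, zero_mul]
    -- A matrix of determinant one carrying `(1, 0)` to `x`; it needs `x 0 ≠ 0`, whence the factor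
    -- `X 0` above.
    have hd : (!![x 0, 0; x 1, (x 0)⁻¹]).det = 1 := by
      rw [Matrix.det_fin_two_of]
      field_simp
      ring
    have hm : (!![x 0, 0; x 1, (x 0)⁻¹]).mulVec ![1, 0] = x := by
      ext i
      fin_cases i <;> simp
    have e1 := hF _ (by rw [hd, one_pow]) u ![1, 0]
    have e2 := hG _ (by rw [hd, one_pow]) u ![1, 0]
    rw [hd, one_pow, one_mul, hm, eval_atQuartic_lead] at e1 e2
    rw [← e1, ← e2, h, sub_self, mul_zero]
  exact (mul_eq_zero.mp h0).resolve_left (X_ne_zero 0)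

/-- The covariants of odd weight are the multiples of `J` by elements of `k[c₄, c₆, U, H]`. -/
theorem IsSemiinvariant.exists_eq_J_mul (h2 : (2 : k) ≠ 0) (h3 : (3 : k) ≠ 0) {F : FormRing k}
    (hF : IsSemiinvariant 1 F) : ∃ β ∈ scalarRing k, F = J k * β := by
  obtain ⟨Q, hQ⟩ := exists_eq_lead_J_mul h2 h3 (f := lead F)
    -- The shear fixes `(1, 0)`, so the leading coefficient is invariant under translations; below,
    -- `diag(1, -1)` also fixes it and has determinant `-1`, which gives the oddness.
    (fun t u => by
      have hd : (!![1, t; 0, 1]).det = 1 := by simp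
      have hm : (!![1, t; 0, 1]).mulVec ![1, 0] = ![1, 0] := by
        ext i
        fin_cases i <;> simp
      have e := hF _ (by rw [hd, one_pow]) u ![1, 0]
      rw [hd, one_pow, one_mul, hm, eval_atQuartic_lead, eval_atQuartic_lead, compCoeffs_eq] at e
      exact e)
    (fun u => by
      have hd : (!![(1 : AlgebraicClosure k), 0; 0, -1]).det = -1 := by simp
      have hm : (!![(1 : AlgebraicClosure k), 0; 0, -1]).mulVec ![1, 0] = ![1, 0] := by
        ext i
        fin_cases i <;> simp
      have e := hF _ (by rw [hd]; norm_num) u ![1, 0]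
      rw [hd, pow_one, neg_one_mul, hm, eval_atQuartic_lead, eval_atQuartic_lead,
        compCoeffs_eq] at e
      exact e)
  refine ⟨scalarHom k Q, scalarHom_mem Q, hF.eq_of_lead_eq ?_ (by rw [hQ, map_mul])⟩
  exact (isEquivariant_J.isSemiinvariant_one (by decide)).mul
    (isSemiinvariant_of_mem_scalarRing (scalarHom_mem Q))

/-! ### Determinants of pairs of columns. -/

/-- `v (U ∘ g; x) = (det g) ^ e adj (g) v (U; g x)` for all `g` of determinant `1` or `-1`, as an
identity between values at points over the algebraic closure. -/
def IsSemiinvariantColumn (e : ℕ) (v : Column k) : Prop :=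
  ∀ g : Matrix (Fin 2) (Fin 2) (AlgebraicClosure k), g.det ^ 2 = 1 →
    ∀ (u : Fin 5 → AlgebraicClosure k) (x : Fin 2 → AlgebraicClosure k) (i : Fin 2),
      eval x (atQuartic (v i) (compCoeffs u g)) = g.det ^ e *
        (!![g 1 1, -g 0 1; -g 1 0, g 0 0] i 0 * eval (g.mulVec x) (atQuartic (v 0) u) +
          !![g 1 1, -g 0 1; -g 1 0, g 0 0] i 1 * eval (g.mulVec x) (atQuartic (v 1) u))

/-- Since `g⁻¹ = (det g)⁻¹ adj g`, the factor is `(det g)^(p - 1)`, which depends only on the parity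
of `p` when `(det g)² = 1`. The resulting relation is linear in `v` and so passes to sums. -/
theorem isSemiinvariantColumn_of_mem_span {P : ℤ → Prop} {e : ℕ}
    (hP : ∀ p, P p → ∀ δ : AlgebraicClosure k, δ ^ 2 = 1 → δ ^ p * δ⁻¹ = δ ^ e) {v : Column k}
    (hv : v ∈ Submodule.span k {v | ∃ (m d : ℕ) (p : ℤ), P p ∧ IsCovariantColumn m d p v}) :
    IsSemiinvariantColumn e v := by
  induction hv using Submodule.span_induction with
  | mem v hv =>
    obtain ⟨m, d, p, hp, hv⟩ := hv
    intro g hg u x i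
    have h0 : g.det ≠ 0 := by intro h; simp [h] at hg
    have h := congrArg (eval x)
      (hv.equivariant (Matrix.GeneralLinearGroup.mkOfDetNeZero g h0) u i)
    rw [Fin.sum_univ_two, inv_apply, inv_apply] at h
    simp only [map_mul, map_add, eval_C, eval_comp] at h
    refine h.trans ?_
    rw [← hP p hp _ hg]
    change g.det ^ p * (g.det⁻¹ * !![g 1 1, -g 0 1; -g 1 0, g 0 0] i 0 *
        eval (g.mulVec x) (atQuartic (v 0) u) +
      g.det⁻¹ * !![g 1 1, -g 0 1; -g 1 0, g 0 0] i 1 *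
        eval (g.mulVec x) (atQuartic (v 1) u)) = _
    ring
  | zero =>
    intro g _ u x i
    simp [atQuartic]
  | add v w _ _ hv hw =>
    intro g hg u x i
    simp only [Pi.add_apply, atQuartic_add, map_add, hv g hg, hw g hg]
    ring
  | smul c v _ hv =>
    intro g hg u x i
    simp only [Pi.smul_apply, atQuartic_smul, map_mul, eval_C, hv g hg]
    ring

theorem isSemiinvariantColumn_of_mem_evenColumns {v : Column k} (hv : v ∈ evenColumns k) :
    IsSemiinvariantColumn 1 v :=
  isSemiinvariantColumn_of_mem_span (fun p hp δ hδ => by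
    rw [zpow_even_of_sq_eq_one hδ hp, one_mul, pow_one]
    exact inv_eq_of_mul_eq_one_left (by rw [← sq, hδ])) hv

theorem isSemiinvariantColumn_of_mem_oddColumns {v : Column k} (hv : v ∈ oddColumns k) :
    IsSemiinvariantColumn 0 v :=
  isSemiinvariantColumn_of_mem_span (fun p hp δ hδ => by
    have h0 : δ ≠ 0 := by rintro rfl; simp at hδ
    rw [zpow_odd_of_sq_eq_one hδ hp, mul_inv_cancel₀ h0, pow_zero]) hv

/-- The determinant of the matrix with columns `v`, `w`. -/
def wedge (v w : Column k) : FormRing k := v 0 * w 1 - v 1 * w 0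

/-- The two factors `(det g)^e` cancel, and `det (adj g) = det g` remains: the determinant is odd
for either parity of the columns. -/
theorem IsSemiinvariantColumn.wedge {e : ℕ} {v w : Column k} (hv : IsSemiinvariantColumn e v)
    (hw : IsSemiinvariantColumn e w) : IsSemiinvariant 1 (wedge v w) := by
  intro g hg u x
  have he : g.det ^ e * g.det ^ e = 1 := by rw [← pow_add, ← two_mul, pow_mul, hg, one_pow]
  simp only [BinaryQuartic.wedge, atQuartic_sub, atQuartic_mul, map_sub, map_mul, hv g hg, hw g hg]
  have hd := Matrix.det_fin_two g
  simp only [Matrix.of_apply, Matrix.cons_val]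
  generalize g.det = δ at *
  subst hd
  linear_combination ((g 0 0 * g 1 1 - g 0 1 * g 1 0) *
    (eval (g.mulVec x) (atQuartic (v 0) u) * eval (g.mulVec x) (atQuartic (w 1) u) -
      eval (g.mulVec x) (atQuartic (v 1) u) * eval (g.mulVec x) (atQuartic (w 0) u))) * he

/-- For the quartic `x₁³ x₂` the leading coefficient of `J` is `1`. -/
theorem J_ne_zero (h2 : (2 : k) ≠ 0) (h3 : (3 : k) ≠ 0) : J k ≠ 0 := by
  intro h
  have e := congrArg (fun F => eval ![0, 1, 0, 0, 0] (lead F)) h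
  simp [lead_J h2 h3] at e

/-- Euler's identity for `J`, of order `6` in `x₁, x₂`. -/
theorem wedge_xColumn_del_J : wedge (xColumn k) (del (J k)) = 6 * J k := by
  have h := (isBihomogeneous_J (k := k)).order.sum_X_mul_pderiv
  rw [Fin.sum_univ_two, nsmul_eq_mul] at h
  simp only [wedge, xColumn, del, Matrix.cons_val]
  push_cast at h
  linear_combination h

theorem wedge_del_U_del_H (h12 : (12 : k) ≠ 0) :
    wedge (del (U k)) (del (H k)) = 12 * J k := by
  have h : (12 : FormRing k) * J k = (12 : k) • J k := by
    rw [smul_eq_C_C_mul, map_ofNat, map_ofNat]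
  rw [h, J, smul_inv_smul₀ h12]
  simp only [wedge, del, Matrix.cons_val]
  ring

/-! ### Freeness by Cramer's rule. -/

theorem isFreeSubmoduleWithBasis_pair {A N : Type*} [CommRing A] [AddCommGroup N] [Module A N]
    {V : Set N} {e₀ e₁ : N} (hli : ∀ s t : A, s • e₀ + t • e₁ = 0 → s = 0 ∧ t = 0)
    (hV : ∀ v, v ∈ V ↔ ∃ s t : A, s • e₀ + t • e₁ = v) :
    IsFreeSubmoduleWithBasis A V ![e₀, e₁] := by
  have h : LinearIndependent A ![e₀, e₁] := LinearIndependent.pair_iff.mpr hli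
  refine ⟨Submodule.span A (Set.range ![e₀, e₁]), ?_, Module.Basis.span h,
    fun i => congrArg Subtype.val (Module.Basis.span_apply h i)⟩
  ext v
  rw [hV, Matrix.range_cons_cons_empty, SetLike.mem_coe, Submodule.mem_span_pair]

/-- A submodule of columns on which the determinant takes values in `J k[c₄, c₆, U, H]` is free
on any two of its elements whose determinant is a nonzero constant times `J`. -/
theorem isFreeSubmoduleWithBasis_of_wedge {V : Submodule k (Column k)}
    (hJ : J k ≠ 0)
    (hsmul : ∀ F ∈ scalarRing k, ∀ v ∈ V, F • v ∈ V)
    (hwedge : ∀ v ∈ V, ∀ w ∈ V, ∃ β ∈ scalarRing k, wedge v w = J k * β)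
    {e₀ e₁ : Column k} (h0 : e₀ ∈ V) (h1 : e₁ ∈ V) {c : k} (hc : c ≠ 0)
    (h01 : wedge e₀ e₁ = c • J k) :
    IsFreeSubmoduleWithBasis (scalarRing k) (V : Set (Column k)) ![e₀, e₁] := by
  have hcJ : c • J k ≠ 0 := smul_ne_zero hc hJ
  refine isFreeSubmoduleWithBasis_pair (fun s t hst => ?_) (fun v => ⟨fun hv => ?_, ?_⟩)
  · have hst' : (s : FormRing k) • e₀ + (t : FormRing k) • e₁ = 0 := hst
    have x0 := congrFun hst' 0
    have x1 := congrFun hst' 1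
    simp only [Pi.add_apply, Pi.smul_apply, smul_eq_mul, Pi.zero_apply] at x0 x1
    rw [wedge] at h01
    constructor
    · refine Subtype.ext ((mul_eq_zero.mp (?_ : (s : FormRing k) * (c • J k) = 0)).resolve_right hcJ)
      rw [← h01]
      linear_combination e₁ 1 * x0 - e₁ 0 * x1
    · refine Subtype.ext ((mul_eq_zero.mp (?_ : (t : FormRing k) * (c • J k) = 0)).resolve_right hcJ)
      rw [← h01]
      linear_combination e₀ 0 * x1 - e₀ 1 * x0
  · obtain ⟨α, hα, hα'⟩ := hwedge v hv e₁ h1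
    obtain ⟨β, hβ, hβ'⟩ := hwedge e₀ h0 v hv
    refine ⟨⟨c⁻¹ • α, Subalgebra.smul_mem _ hα _⟩, ⟨c⁻¹ • β, Subalgebra.smul_mem _ hβ _⟩, ?_⟩
    change (c⁻¹ • α) • e₀ + (c⁻¹ • β) • e₁ = v
    -- Cramer's rule `(e₀ ∧ e₁) v = (v ∧ e₁) e₀ + (e₀ ∧ v) e₁`, with the common factor `J`
    -- cancelled.
    have key : c • v = α • e₀ + β • e₁ := by
      ext1 i
      refine mul_left_cancel₀ hJ ?_
      have : J k * (c • v) i = wedge e₀ e₁ * v i := by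
        rw [h01, Pi.smul_apply, mul_smul_comm, smul_mul_assoc]
      rw [this]
      simp only [Pi.add_apply, Pi.smul_apply, smul_eq_mul]
      rw [mul_add, ← mul_assoc, ← mul_assoc, ← hα', ← hβ']
      fin_cases i <;> simp [wedge] <;> ring
    rw [smul_assoc, smul_assoc, ← smul_add, ← key, inv_smul_smul₀ hc]
  · rintro ⟨α, β, rfl⟩
    exact V.add_mem (hsmul α α.2 _ h0) (hsmul β β.2 _ h1)

end BinaryQuartic

end

theorem mainTheorem8 (k : Type*) [Field k] (h2 : ringChar k ≠ 2) (h3 : ringChar k ≠ 3) :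
    BinaryQuartic.IsFreeSubmoduleWithBasis (BinaryQuartic.scalarRing k)
      (BinaryQuartic.evenColumns k : Set (BinaryQuartic.Column k))
      ![BinaryQuartic.xColumn k, BinaryQuartic.del (BinaryQuartic.J k)] ∧
    BinaryQuartic.IsFreeSubmoduleWithBasis (BinaryQuartic.scalarRing k)
      (BinaryQuartic.oddColumns k : Set (BinaryQuartic.Column k))
      ![BinaryQuartic.del (BinaryQuartic.U k), BinaryQuartic.del (BinaryQuartic.H k)] := by
  have h2' : (2 : k) ≠ 0 := Ring.two_ne_zero h2
  have h3' : (3 : k) ≠ 0 := BinaryQuartic.three_ne_zero_of_ringChar h3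
  have h6 : (6 : k) ≠ 0 := by
    rw [show (6 : k) = 2 * 3 by norm_num]
    exact mul_ne_zero h2' h3'
  have h12 : (12 : k) ≠ 0 := by
    rw [show (12 : k) = 2 * 6 by norm_num]
    exact mul_ne_zero h2' h6
  constructor
  · refine BinaryQuartic.isFreeSubmoduleWithBasis_of_wedge (BinaryQuartic.J_ne_zero h2' h3')
      (fun F hF v hv => BinaryQuartic.smul_mem_span (fun p q hp hq => hp.add hq) hF hv)
      (fun v hv w hw => ((BinaryQuartic.isSemiinvariantColumn_of_mem_evenColumns hv).wedge
        (BinaryQuartic.isSemiinvariantColumn_of_mem_evenColumns hw)).exists_eq_J_mul h2' h3')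
      (Submodule.subset_span ⟨_, _, _, by decide, BinaryQuartic.isCovariantColumn_xColumn⟩)
      (Submodule.subset_span ⟨_, _, _, by decide, BinaryQuartic.isCovariantColumn_del
        BinaryQuartic.isBihomogeneous_J BinaryQuartic.isEquivariant_J⟩) h6 ?_
    rw [BinaryQuartic.wedge_xColumn_del_J, BinaryQuartic.smul_eq_C_C_mul, map_ofNat, map_ofNat]
  · refine BinaryQuartic.isFreeSubmoduleWithBasis_of_wedge (BinaryQuartic.J_ne_zero h2' h3')
      (fun F hF v hv => BinaryQuartic.smul_mem_span (fun p q hp hq => hp.add_odd hq) hF hv)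
      (fun v hv w hw => ((BinaryQuartic.isSemiinvariantColumn_of_mem_oddColumns hv).wedge
        (BinaryQuartic.isSemiinvariantColumn_of_mem_oddColumns hw)).exists_eq_J_mul h2' h3')
      (Submodule.subset_span ⟨_, _, _, by decide, BinaryQuartic.isCovariantColumn_del
        BinaryQuartic.isBihomogeneous_U BinaryQuartic.isEquivariant_U⟩)
      (Submodule.subset_span ⟨_, _, _, by decide, BinaryQuartic.isCovariantColumn_del
        BinaryQuartic.isBihomogeneous_H BinaryQuartic.isEquivariant_H⟩) h12 ?_
    rw [BinaryQuartic.wedge_del_U_del_H h12, BinaryQuartic.smul_eq_C_C_mul, map_ofNat, map_ofNat]
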